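/- Let $f:[0,1)\to[0,1)$, $f(x)=2x \bmod 1$, be the doubling map, let $\mu$ be Lebesgue measure on $[0,1)$, $d(x,y)=|x-y|$, and let $\rho\equiv 1$. Let $c>1/2$ and $r_n=\dfrac{c\log\log n}{n}$. Then the following hold. (1) The system $([0,1),f,\mu)$ is hyperbolic recurrent with invariant density $\rho$, that is: $\mu$ is an ergodic $f$-invariant probability measure with density $\rho$ of bounded variation with respect to Lebesgue measure, and (A1) there are $C>0$ and $\theta\in(0,1)$ such that for all $\varphi_1$ of bounded variation on $[0,1)$, all $\varphi_2\in L^1(\mu)$ and all $j\ge 0$, $$\Bigl|\int\varphi_1\cdot\varphi_2\circ f^j\,d\mu-\int\varphi_1\,d\mu\int\varphi_2\,d\mu\Bigr|\le C\theta^j\,\|\varphi_1\|_{\mathrm{BV}}\,\|\varphi_2\|_{L^1(\mu)},\qquad \|\varphi\|_{\mathrm{BV}}=\mathrm{var}(\varphi)+\sup|\varphi|;$$ (A2) for every $a>0$ and every real sequence $(s_n)$ for which there is $\kappa>1$ with $\kappa^{-1}n^{-a}\le s_n\le \kappa n^{-a}$ for all large $n$, there are $\beta_0\in(0,1)$ and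 $C>0$ such that for all sufficiently large $n$ and all integers $1\le j\le(\log n)^2$, $$\mu\bigl(\{x\in[0,1):d(x,f^jx)\le s_n\}\bigr)\le C s_n^{\beta_0}.$$ (2) The density $\rho$ is strictly positive, and there is $c'$ with $2c'\min_{x\in[0,1)}\rho(x)>1$ such that $r_n>\dfrac{c'\log\log n}{n}$ for all sufficiently large $n$. (3) For $\mu$-almost every $x\in[0,1)$ there is $N$ such that for all $n\ge N$, $$\min_{1\le k\le n}d(f^kx,x)<r_n .$$ -/

import Mathlib

open MeasureTheory Filter

noncomputable section

/-- The BV norm `var_X(φ) + sup_X |φ|` of a function on `X ⊆ ℝ`, as an extended number. -/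
def bvNorm (X : Set ℝ) (φ : ℝ → ℝ) : ENNReal :=
  eVariationOn φ X + ⨆ x ∈ X, ENNReal.ofReal |φ x|

/-- Exponential decay of correlations, BV against `L¹(μ)`:
`|∫ φ₁ · φ₂ ∘ f^j dμ - ∫ φ₁ dμ ∫ φ₂ dμ| ≤ C θ^j ‖φ₁‖_BV ‖φ₂‖₁` with some `C > 0`, `0 < θ < 1`. -/
def HasExpDecayBVL1 (X : Set ℝ) (f : ℝ → ℝ) (μ : Measure ℝ) : Prop :=
  ∃ C θ : ℝ, 0 < C ∧ 0 < θ ∧ θ < 1 ∧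
    ∀ φ₁ φ₂ : ℝ → ℝ, bvNorm X φ₁ < ⊤ → Integrable φ₂ μ → ∀ j : ℕ,
      |(∫ x, φ₁ x * φ₂ (f^[j] x) ∂μ) - (∫ x, φ₁ x ∂μ) * ∫ x, φ₂ x ∂μ|
        ≤ C * θ ^ j * (bvNorm X φ₁).toReal * ∫ x, |φ₂ x| ∂μ

/-- `E_j(r)`: the points of `X` that are within `r` of their `j`-th iterate. -/
def returnSet (X : Set ℝ) (f : ℝ → ℝ) (j : ℕ) (r : ℝ) : Set ℝ :=
  {x | x ∈ X ∧ dist x (f^[j] x) ≤ r}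

/-- Short return condition: whenever `r_n ≈ n^{-a}` with `a > 0`, there are `β₀ ∈ (0,1)` and `C > 0`
with `μ(E_j(r_n)) ≤ C r_n^{β₀}` for all (large) `n` and all `1 ≤ j ≤ (log n)²`. -/
def HasFewShortReturns (X : Set ℝ) (f : ℝ → ℝ) (μ : Measure ℝ) : Prop :=
  ∀ (a : ℝ) (r : ℕ → ℝ), 0 < a →
    (∃ κ : ℝ, 1 < κ ∧
      ∀ᶠ n : ℕ in atTop, κ⁻¹ * (n : ℝ) ^ (-a) ≤ r n ∧ r n ≤ κ * (n : ℝ) ^ (-a)) →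
    ∃ β₀ C : ℝ, 0 < β₀ ∧ β₀ < 1 ∧ 0 < C ∧
      ∀ᶠ n : ℕ in atTop, ∀ j : ℕ, 1 ≤ j → (j : ℝ) ≤ Real.log n ^ 2 →
        μ.real (returnSet X f j (r n)) ≤ C * r n ^ β₀

/-- The interval system `(X, f, μ)` is hyperbolic recurrent, with invariant density `ρ`.
Functions on `X` are represented by functions on `ℝ`; only their values on `X` matter. -/
structure IsHyperbolicRecurrent (X : Set ℝ) (f : ℝ → ℝ) (μ : Measure ℝ) (ρ : ℝ → ℝ) : Prop where
  ordConnected : X.OrdConnected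
  mapsTo : Set.MapsTo f X X
  isProbabilityMeasure : IsProbabilityMeasure μ
  ergodic : Ergodic f μ
  density_nonneg : ∀ x ∈ X, 0 ≤ ρ x
  density : μ = (volume.restrict X).withDensity (fun x => ENNReal.ofReal (ρ x))
  density_bv : bvNorm X ρ < ⊤
  decay : HasExpDecayBVL1 X f μ
  short_returns : HasFewShortReturns X f μ

/-- The additional hypotheses for the almost sure upper bound with a positive density:
`ρ` is strictly positive on `X`, and `r_n > c' log log n / n` (for large `n`) for some `c'` with
`2 c' min_X ρ > 1`. -/
def IsUpperBoundSequence (X : Set ℝ) (ρ : ℝ → ℝ) (r : ℕ → ℝ) : Prop :=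
  (∀ x ∈ X, 0 < ρ x) ∧
    ∃ m c' : ℝ, IsLeast (ρ '' X) m ∧ 1 < 2 * c' * m ∧
      ∀ᶠ n : ℕ in atTop, c' * Real.log (Real.log n) / n < r n

/-- `min_{1 ≤ k ≤ n} d(f^k x, x)` (a minimum when `n ≥ 1`, see `isLeast_minReturn`). -/
def minReturn (f : ℝ → ℝ) (n : ℕ) (x : ℝ) : ℝ :=
  sInf ((fun k : ℕ => dist (f^[k] x) x) '' Set.Icc 1 n)

theorem isLeast_minReturn (f : ℝ → ℝ) {n : ℕ} (hn : 1 ≤ n) (x : ℝ) :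
    IsLeast ((fun k : ℕ => dist (f^[k] x) x) '' Set.Icc 1 n) (minReturn f n x) := by
  have hfin : ((fun k : ℕ => dist (f^[k] x) x) '' Set.Icc 1 n).Finite :=
    (Set.finite_Icc 1 n).image _
  have hne : ((fun k : ℕ => dist (f^[k] x) x) '' Set.Icc 1 n).Nonempty :=
    (Set.nonempty_Icc.2 hn).image _
  exact ⟨hne.csInf_mem hfin, fun y hy => csInf_le hfin.bddBelow hy⟩

/-- The doubling map `x ↦ 2x mod 1`. -/
def doublingMap (x : ℝ) : ℝ := Int.fract (2 * x)

/-- Lebesgue measure on `[0,1)`. -/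
def lebUnit : Measure ℝ := volume.restrict (Set.Ico 0 1)

end

/-!
The transfer operator of the doubling map halves the variation, which gives exponential decay of
correlations, hence ergodicity; the condition `|x - fʲ x| ≤ r` cuts out of each of the `2ʲ` branch
domains a set of measure at most `4 r 2⁻ʲ`, which gives few short returns.

For the almost sure bound, let `B` be the union of the dyadic intervals of length `2⁻ᴹ` that lie
within `m` steps of a given one, `I`. A point of `I` whose orbit avoids `B` during the times from
`M` to `M + q (L + M)` has `q` consecutive orbit blocks of length `L`, separated by gaps of length
`M`, which avoid `B`, and these `q` events are independent because they depend on disjoint sets of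
binary digits. By the second Bonferroni inequality each block meets `B` with probability at least
`L (μ(B) - ∑_{1 ≤ j ≤ L} μ(B ∩ f⁻ʲ B))`. By the bound on short returns, for most `I` the sum is
negligible compared with `μ(B)`. Summing over `I`, the points without a return closer than `r` up
to time `n ≈ q L` have measure at most about `exp(-2 r n)`. Along the geometric times `n = l ^ k`
with `2 r n ≈ 2 c log k` this is `k ^ (-2 c)`, which is summable as `2 c > 1`, and Borel–Cantelli
applies; taking `l` close to `1` interpolates between these times.
-/

open scoped Topology

/-! ### Functions of bounded variation -/

section BoundedVariation

theorem sum_edist_le_eVariationOn {α E : Type*} [LinearOrder α] [PseudoEMetricSpace E] (φ : α → E)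
    {t y z : ℕ → α} (ht : Monotone t) (hy : ∀ k, y k ∈ Set.Ico (t k) (t (k + 1)))
    (hz : ∀ k, z k ∈ Set.Ico (t k) (t (k + 1))) (n : ℕ) :
    ∑ k ∈ Finset.range n, edist (φ (y k)) (φ (z k)) ≤ eVariationOn φ (Set.Ico (t 0) (t n)) := by
  induction n with
  | zero => simp
  | succ n ih =>
    calc ∑ k ∈ Finset.range (n + 1), edist (φ (y k)) (φ (z k))
        ≤ eVariationOn φ (Set.Ico (t 0) (t n)) + eVariationOn φ (Set.Ico (t n) (t (n + 1))) := by
          rw [Finset.sum_range_succ]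
          exact add_le_add ih (eVariationOn.edist_le φ (hy n) (hz n))
      _ ≤ eVariationOn φ (Set.Ico (t 0) (t n) ∪ Set.Ico (t n) (t (n + 1))) :=
          eVariationOn.add_le_union φ fun x hx y hy => hx.2.le.trans hy.1
      _ = eVariationOn φ (Set.Ico (t 0) (t (n + 1))) := by
          rw [Set.Ico_union_Ico_eq_Ico (ht n.zero_le) (ht n.le_succ)]

variable {X : Set ℝ} {φ : ℝ → ℝ}

theorem abs_le_toReal_bvNorm (hφ : bvNorm X φ < ⊤) {x : ℝ} (hx : x ∈ X) :
    |φ x| ≤ (bvNorm X φ).toReal := by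
  rw [← ENNReal.ofReal_le_iff_le_toReal hφ.ne]
  exact (le_iSup₂ (f := fun x (_ : x ∈ X) => ENNReal.ofReal |φ x|) x hx).trans le_add_self

theorem bvNorm_lt_top_of_monotoneOn (hφ : MonotoneOn φ X) {a b : ℝ}
    (hab : Set.MapsTo φ X (Set.Icc a b)) : bvNorm X φ < ⊤ := by
  have hvar : eVariationOn φ X ≤ ENNReal.ofReal (b - a) :=
    calc eVariationOn (id ∘ φ) X ≤ eVariationOn id (Set.univ ∩ Set.Icc a b) :=
          eVariationOn.comp_le_of_monotoneOn id φ hφ fun x hx => ⟨trivial, hab hx⟩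
      _ ≤ ENNReal.ofReal (b - a) :=
          ((monotone_id.monotoneOn Set.univ).eVariationOn_eq trivial trivial).le
  have hsup : ⨆ x ∈ X, ENNReal.ofReal |φ x| ≤ ENNReal.ofReal (max |a| |b|) :=
    iSup₂_le fun x hx => ENNReal.ofReal_le_ofReal (abs_le_max_abs_abs (hab hx).1 (hab hx).2)
  exact (add_le_add hvar hsup).trans_lt (by finiteness)

theorem bvNorm_indicator_Ici_lt_top (X : Set ℝ) (a : ℝ) :
    bvNorm X ((Set.Ici a).indicator 1) < ⊤ := by
  refine bvNorm_lt_top_of_monotoneOn (a := 0) (b := 1) (fun x _ y _ hxy => ?_) fun x _ => ?_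
  · by_cases hx : a ≤ x
    · simp [hx, hx.trans hxy]
    · rw [Set.indicator_of_notMem (by simpa using hx)]
      exact Set.indicator_nonneg (fun _ _ => zero_le_one) _
  · by_cases hx : a ≤ x <;> simp [hx]

theorem integrableOn_of_bvNorm_lt_top {μ : Measure ℝ} (hX : MeasurableSet X) (hμX : μ X ≠ ⊤)
    (hφ : bvNorm X φ < ⊤) : IntegrableOn φ X μ := by
  have hvar : BoundedVariationOn φ X := (le_self_add.trans_lt hφ).ne
  obtain ⟨p, q, hp, hq, hpq⟩ := hvar.locallyBoundedVariationOn.exists_monotoneOn_sub_monotoneOn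
  have hmeas : AEStronglyMeasurable φ (μ.restrict X) := by
    rw [hpq]
    exact ((aemeasurable_restrict_of_monotoneOn hX hp).sub
      (aemeasurable_restrict_of_monotoneOn hX hq)).aestronglyMeasurable
  exact .of_bound hμX.lt_top hmeas (bvNorm X φ).toReal
    ((ae_restrict_mem hX).mono fun x hx => abs_le_toReal_bvNorm hφ hx)

end BoundedVariation

/-! ### Decay of correlations and ergodicity -/

namespace HasExpDecayBVL1

variable {X : Set ℝ} {f : ℝ → ℝ} {μ : Measure ℝ}

theorem setIntegral_eq_mul_of_preimage_eq [IsFiniteMeasure μ] (h : HasExpDecayBVL1 X f μ)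
    {s : Set ℝ} (hs : MeasurableSet s) (hinv : f ⁻¹' s = s) {φ : ℝ → ℝ} (hφ : bvNorm X φ < ⊤) :
    ∫ x in s, φ x ∂μ = (∫ x, φ x ∂μ) * μ.real s := by
  obtain ⟨C, θ, -, hθ, hθ1, hdecay⟩ := h
  have hiter (j : ℕ) : f^[j] ⁻¹' s = s := by
    rw [Set.preimage_iterate_eq]
    exact Function.iterate_fixed hinv j
  have hcorr (j : ℕ) : ∫ x, φ x * s.indicator 1 (f^[j] x) ∂μ = ∫ x in s, φ x ∂μ := by
    rw [← integral_indicator hs]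
    congr 1 with x
    have hmem : f^[j] x ∈ s ↔ x ∈ s := by rw [← Set.mem_preimage, hiter]
    by_cases hx : x ∈ s <;> simp [hmem, hx]
  have hbound (j : ℕ) := hdecay φ (s.indicator 1) hφ ((integrable_const 1).indicator hs) j
  simp only [hcorr, integral_indicator_one hs] at hbound
  have hlim := (((tendsto_pow_atTop_nhds_zero_of_lt_one hθ.le hθ1).const_mul C).mul_const
    (bvNorm X φ).toReal).mul_const (∫ x, |s.indicator 1 x| ∂μ)
  simp only [mul_zero, zero_mul] at hlim
  exact sub_eq_zero.1 (abs_nonpos_iff.1 (ge_of_tendsto' hlim hbound))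

theorem ergodic [IsProbabilityMeasure μ] (h : HasExpDecayBVL1 X f μ)
    (hf : MeasurePreserving f μ μ) : Ergodic f μ := by
  refine ⟨hf, ⟨fun s hs hinv => ?_⟩⟩
  have hrestrict : μ.restrict s = μ s • μ := by
    refine Measure.ext_of_Ici _ _ fun a => ?_
    have hIci := h.setIntegral_eq_mul_of_preimage_eq hs hinv (bvNorm_indicator_Ici_lt_top X a)
    rw [integral_indicator_one measurableSet_Ici, integral_indicator_one measurableSet_Ici] at hIci
    rw [Measure.smul_apply, smul_eq_mul, mul_comm,
      ← ENNReal.toReal_eq_toReal_iff' (by finiteness) (by finiteness), ENNReal.toReal_mul]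
    exact hIci
  have hself : μ s * μ s = μ s := by simpa using congrArg (· s) hrestrict.symm
  rw [eventuallyConst_set']
  rcases eq_or_ne (μ s) 0 with h0 | h0
  · exact .inl (ae_eq_empty.2 h0)
  · right
    rw [ae_eq_univ, prob_compl_eq_zero_iff hs]
    exact (ENNReal.mul_eq_left h0 (measure_ne_top _ _)).1 hself

end HasExpDecayBVL1

/-! ### Hitting times and return times -/

section Hitting

variable {α : Type*} [MeasurableSpace α] {μ : Measure α} {f : α → α} {B : Set α}

theorem sum_sub_sum_inter_le_measureReal_biUnion [IsFiniteMeasure μ] {A : ℕ → Set α}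
    (hA : ∀ i, MeasurableSet (A i)) (L : ℕ) :
    ∑ j ∈ Finset.range L, (μ.real (A j) - ∑ i ∈ Finset.range j, μ.real (A i ∩ A j)) ≤
      μ.real (⋃ i ∈ Finset.range L, A i) := by
  induction L with
  | zero => simp
  | succ L ih =>
    have hinter : μ.real ((⋃ i ∈ Finset.range L, A i) ∩ A L) ≤
        ∑ i ∈ Finset.range L, μ.real (A i ∩ A L) := by
      simp only [Set.iUnion_inter]
      exact measureReal_biUnion_finset_le _ _
    have hunion := measureReal_union_add_inter (μ := μ) (s := ⋃ i ∈ Finset.range L, A i) (hA L)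
      (measure_ne_top _ _) (measure_ne_top _ _)
    rw [Finset.sum_range_succ, Finset.range_add_one, Finset.set_biUnion_insert, Set.union_comm]
    linarith

/-- The total correlation `∑_{1 ≤ j ≤ L} μ(B ∩ f⁻ʲ B)` of the returns of `B` to itself up to
time `L`. -/
noncomputable def returnSum (f : α → α) (μ : Measure α) (L : ℕ) (B : Set α) : ℝ :=
  ∑ j ∈ Finset.range L, μ.real (B ∩ f^[j + 1] ⁻¹' B)

theorem returnSum_nonneg (f : α → α) (μ : Measure α) (L : ℕ) (B : Set α) :
    0 ≤ returnSum f μ L B :=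
  Finset.sum_nonneg fun _ _ => measureReal_nonneg

theorem returnSum_mono (f : α → α) (μ : Measure α) (B : Set α) :
    Monotone fun L => returnSum f μ L B := fun _ _ h =>
  Finset.sum_le_sum_of_subset_of_nonneg (Finset.range_mono h) fun _ _ _ => measureReal_nonneg

theorem mul_sub_returnSum_le_measureReal_exists [IsFiniteMeasure μ] (hf : MeasurePreserving f μ μ)
    (hB : MeasurableSet B) (L : ℕ) :
    L * (μ.real B - returnSum f μ L B) ≤ μ.real {x | ∃ i < L, f^[i] x ∈ B} := by
  have hmeas (i : ℕ) : MeasurableSet (f^[i] ⁻¹' B) := hf.measurable.iterate i hB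
  have hpair {i j : ℕ} (hij : i < j) :
      μ.real (f^[i] ⁻¹' B ∩ f^[j] ⁻¹' B) = μ.real (B ∩ f^[j - 1 - i + 1] ⁻¹' B) := by
    rw [← (hf.iterate i).measureReal_preimage (hB.inter (hmeas _)).nullMeasurableSet,
      Set.preimage_inter, ← Set.preimage_comp, ← Function.iterate_add]
    congr 4
    omega
  have hrow {j : ℕ} (hj : j < L) :
      ∑ i ∈ Finset.range j, μ.real (f^[i] ⁻¹' B ∩ f^[j] ⁻¹' B) ≤ returnSum f μ L B := by
    rw [Finset.sum_congr rfl fun i hi => hpair (Finset.mem_range.1 hi),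
      Finset.sum_range_reflect (fun d => μ.real (B ∩ f^[d + 1] ⁻¹' B))]
    exact returnSum_mono f μ B hj.le
  calc L * (μ.real B - returnSum f μ L B)
      = ∑ _j ∈ Finset.range L, (μ.real B - returnSum f μ L B) := by
        rw [Finset.sum_const, Finset.card_range, nsmul_eq_mul]
    _ ≤ ∑ j ∈ Finset.range L, (μ.real (f^[j] ⁻¹' B) -
          ∑ i ∈ Finset.range j, μ.real (f^[i] ⁻¹' B ∩ f^[j] ⁻¹' B)) := by
        refine Finset.sum_le_sum fun j hj => ?_
        rw [(hf.iterate j).measureReal_preimage hB.nullMeasurableSet]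
        exact sub_le_sub_left (hrow (Finset.mem_range.1 hj)) _
    _ ≤ μ.real (⋃ i ∈ Finset.range L, f^[i] ⁻¹' B) :=
        sum_sub_sum_inter_le_measureReal_biUnion hmeas L
    _ = μ.real {x | ∃ i < L, f^[i] x ∈ B} := by
        congr 1
        ext x
        simp

theorem measureReal_forall_iterate_mem [IsProbabilityMeasure μ] {g : α → α} (hg : Measurable g)
    {D : Set α} (hD : MeasurableSet D)
    (hindep : ∀ A, MeasurableSet A → μ.real (D ∩ g ⁻¹' A) = μ.real D * μ.real A) (q : ℕ) :
    μ.real {x | ∀ t < q, g^[t] x ∈ D} = μ.real D ^ q := by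
  induction q with
  | zero => simp
  | succ q ih =>
    have hsucc : {x | ∀ t < q + 1, g^[t] x ∈ D} = D ∩ g ⁻¹' {x | ∀ t < q, g^[t] x ∈ D} := by
      ext x
      simp only [Set.mem_ofPred_eq, Set.mem_inter_iff, Set.mem_preimage, Nat.forall_lt_succ_left,
        Function.iterate_zero, id, Function.iterate_succ_apply]
    have hmeas : MeasurableSet {x | ∀ t < q, g^[t] x ∈ D} := by
      simp only [Set.ofPred_forall]
      exact .iInter fun t => .iInter fun _ => hg.iterate t hD
    rw [hsucc, hindep _ hmeas, ih, pow_succ']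

theorem sum_measureReal_inter_le_mul [IsFiniteMeasure μ] {ι : Type*} {s : Finset ι}
    {A : ι → Set α} (hA : ∀ i, MeasurableSet (A i)) {K : ℕ}
    [∀ x, DecidablePred fun i => x ∈ A i] (hK : ∀ x, (s.filter fun i => x ∈ A i).card ≤ K)
    (E : Set α) : ∑ i ∈ s, μ.real (A i ∩ E) ≤ K * μ.real E := by
  have hle : ∑ i ∈ s, μ (A i ∩ E) ≤ K * μ E :=
    calc ∑ i ∈ s, μ (A i ∩ E) = ∑ i ∈ s, ∫⁻ x in E, (A i).indicator 1 x ∂μ := by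
          simp only [lintegral_indicator_one (hA _), Measure.restrict_apply (hA _)]
      _ = ∫⁻ x in E, ∑ i ∈ s, (A i).indicator 1 x ∂μ :=
          (lintegral_finsetSum _ fun i _ => measurable_one.indicator (hA i)).symm
      _ ≤ ∫⁻ _ in E, K ∂μ := by
          refine lintegral_mono fun x => ?_
          simp only [Set.indicator_apply, Pi.one_apply, Finset.sum_boole]
          exact_mod_cast hK x
      _ = K * μ E := by simp
  have := ENNReal.toReal_mono (by finiteness) hle
  rwa [ENNReal.toReal_sum fun _ _ => measure_ne_top _ _, ENNReal.toReal_mul,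
    ENNReal.toReal_natCast] at this

end Hitting

/-! ### Return sets -/

theorem hasFewShortReturns_of_measureReal_returnSet_le_mul {X : Set ℝ} {f : ℝ → ℝ} {μ : Measure ℝ}
    {C : ℝ} (hC : 0 < C)
    (h : ∀ j, 1 ≤ j → ∀ r, 0 ≤ r → μ.real (returnSet X f j r) ≤ C * r) :
    HasFewShortReturns X f μ := by
  rintro a r ha ⟨κ, hκ, hr⟩
  refine ⟨1 / 2, C, by norm_num, by norm_num, hC, ?_⟩
  have hlim : Tendsto (fun n : ℕ => κ * (n : ℝ) ^ (-a)) atTop (𝓝 0) := by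
    simpa using ((tendsto_rpow_neg_atTop ha).comp tendsto_natCast_atTop_atTop).const_mul κ
  filter_upwards [hr, hlim.eventually_lt_const one_pos] with n hn h1 j hj _
  have h0 : 0 ≤ r n := le_trans (by positivity) hn.1
  refine (h j hj (r n) h0).trans (mul_le_mul_of_nonneg_left ?_ hC.le)
  exact Real.self_le_rpow_of_le_one h0 (hn.2.trans h1.le) (by norm_num)

section NoReturn

/-- The points that do not come back strictly within distance `r` of themselves during the first
`n` steps. -/
def noReturnSet {α : Type*} [Dist α] (f : α → α) (n : ℕ) (r : ℝ) : Set α :=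
  {x | ∀ j, 1 ≤ j → j ≤ n → r ≤ dist (f^[j] x) x}

theorem noReturnSet_anti {α : Type*} [Dist α] (f : α → α) (n : ℕ) : Antitone (noReturnSet f n) :=
  fun _ _ hrs _ hx j hj hjn => hrs.trans (hx j hj hjn)

theorem minReturn_lt_of_notMem_noReturnSet {f : ℝ → ℝ} {m n : ℕ} {x r s : ℝ}
    (hx : x ∉ noReturnSet f m r) (hmn : m ≤ n) (hrs : r ≤ s) : minReturn f n x < s := by
  simp only [noReturnSet, Set.mem_ofPred_eq, not_forall, not_le] at hx
  obtain ⟨j, hj, hjm, hlt⟩ := hx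
  have hjn : j ∈ Set.Icc 1 n := ⟨hj, hjm.trans hmn⟩
  exact ((isLeast_minReturn f (hj.trans hjn.2) x).2 ⟨j, hjn, rfl⟩).trans_lt (hlt.trans_le hrs)

end NoReturn

/-! ### The doubling map and its transfer operators -/

section DoublingMap

instance isProbabilityMeasure_lebUnit : IsProbabilityMeasure lebUnit := ⟨by simp [lebUnit]⟩

theorem ae_lebUnit_mem_Ico : ∀ᵐ x ∂lebUnit, x ∈ Set.Ico (0 : ℝ) 1 :=
  ae_restrict_mem measurableSet_Ico

theorem measurable_doublingMap : Measurable doublingMap :=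
  measurable_fract.comp (measurable_const_mul 2)

theorem mapsTo_doublingMap : Set.MapsTo doublingMap (Set.Ico 0 1) (Set.Ico 0 1) := fun _ _ =>
  ⟨Int.fract_nonneg _, Int.fract_lt_one _⟩

theorem iterate_doublingMap_eq_fract {x : ℝ} (hx : x ∈ Set.Ico (0 : ℝ) 1) (j : ℕ) :
    doublingMap^[j] x = Int.fract (2 ^ j * x) := by
  induction j with
  | zero => simpa using (Int.fract_eq_self.2 hx).symm
  | succ j ih =>
    rw [Function.iterate_succ_apply', ih, doublingMap, Int.fract_eq_fract]
    refine ⟨-(2 * ⌊2 ^ j * x⌋), ?_⟩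
    rw [Int.fract]
    push_cast
    ring

/-- The `k`-th inverse branch of the `M`-th iterate of the doubling map (for `k < 2 ^ M`). -/
noncomputable def invBranch (M k : ℕ) (y : ℝ) : ℝ := (y + k) / 2 ^ M

theorem measurable_invBranch (M k : ℕ) : Measurable (invBranch M k) := by
  unfold invBranch
  fun_prop

theorem two_pow_mul_invBranch (M k : ℕ) (y : ℝ) : 2 ^ M * invBranch M k y = y + k :=
  mul_div_cancel₀ _ (by positivity)

theorem invBranch_mem_Ico_iff {M k : ℕ} {y : ℝ} :
    invBranch M k y ∈ Set.Ico ((k : ℝ) / 2 ^ M) ((k + 1 : ℕ) / 2 ^ M) ↔ y ∈ Set.Ico (0 : ℝ) 1 := by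
  have h2 : (0 : ℝ) < 2 ^ M := by positivity
  rw [invBranch, Set.mem_Ico, div_le_div_iff_of_pos_right h2, div_lt_div_iff_of_pos_right h2,
    Nat.cast_add_one, le_add_iff_nonneg_left, add_comm (k : ℝ), add_lt_add_iff_right, Set.mem_Ico]

theorem monotone_natCast_div_two_pow (M : ℕ) : Monotone fun k : ℕ => (k : ℝ) / 2 ^ M :=
  fun _ _ h => by dsimp only; gcongr

theorem invBranch_mem_Ico {M k : ℕ} (hk : k < 2 ^ M) {y : ℝ} (hy : y ∈ Set.Ico (0 : ℝ) 1) :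
    invBranch M k y ∈ Set.Ico (0 : ℝ) 1 := by
  have hmem := invBranch_mem_Ico_iff (M := M) (k := k).2 hy
  refine ⟨hmem.1.trans' (by positivity), hmem.2.trans_le ?_⟩
  rw [div_le_one (by positivity)]
  exact_mod_cast hk

theorem iterate_invBranch {M k : ℕ} (hk : k < 2 ^ M) {y : ℝ} (hy : y ∈ Set.Ico (0 : ℝ) 1) :
    doublingMap^[M] (invBranch M k y) = y := by
  rw [iterate_doublingMap_eq_fract (invBranch_mem_Ico hk hy), two_pow_mul_invBranch,
    Int.fract_add_natCast, Int.fract_eq_self.2 hy]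

theorem map_invBranch_lebUnit (M k : ℕ) :
    lebUnit.map (invBranch M k) =
      (2 ^ M : ENNReal) • volume.restrict (Set.Ico ((k : ℝ) / 2 ^ M) ((k + 1 : ℕ) / 2 ^ M)) := by
  have hmap : Measure.map (invBranch M k) volume = (2 ^ M : ENNReal) • volume := by
    have hcomp : invBranch M k = (· * (2 ^ M)⁻¹) ∘ (· + (k : ℝ)) :=
      funext fun _ => div_eq_mul_inv _ _
    rw [hcomp, ← Measure.map_map (by fun_prop) (by fun_prop), map_add_right_eq_self,
      Real.map_volume_mul_right (by positivity), inv_inv, abs_of_pos (by positivity),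
      ENNReal.ofReal_pow zero_le_two, ENNReal.ofReal_ofNat]
  have hpre : Set.Ico (0 : ℝ) 1 =
      invBranch M k ⁻¹' Set.Ico ((k : ℝ) / 2 ^ M) ((k + 1 : ℕ) / 2 ^ M) :=
    Set.ext fun _ => invBranch_mem_Ico_iff.symm
  rw [lebUnit, hpre, ← Measure.restrict_map (measurable_invBranch M k) measurableSet_Ico, hmap,
    Measure.restrict_smul]

theorem restrict_Ico_eq_sum {α : Type*} [LinearOrder α] [TopologicalSpace α]
    [OrderClosedTopology α] [MeasurableSpace α] [OpensMeasurableSpace α] (μ : Measure α)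
    {t : ℕ → α} (ht : Monotone t) (n : ℕ) :
    μ.restrict (Set.Ico (t 0) (t n)) =
      ∑ k ∈ Finset.range n, μ.restrict (Set.Ico (t k) (t (k + 1))) := by
  induction n with
  | zero => simp
  | succ n ih =>
    rw [Finset.sum_range_succ, ← ih, ← Measure.restrict_union
      (Set.Ico_disjoint_Ico_same) measurableSet_Ico,
      Set.Ico_union_Ico_eq_Ico (ht n.zero_le) (ht n.le_succ)]

theorem two_pow_smul_lebUnit_eq_sum_map (M : ℕ) :
    (2 ^ M : ENNReal) • lebUnit = ∑ k ∈ Finset.range (2 ^ M), lebUnit.map (invBranch M k) := by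
  have hsum := restrict_Ico_eq_sum volume (monotone_natCast_div_two_pow M) (2 ^ M)
  simp only [Nat.cast_zero, zero_div, Nat.cast_pow, Nat.cast_ofNat,
    div_self (pow_ne_zero M (two_ne_zero (α := ℝ)))] at hsum
  simp_rw [map_invBranch_lebUnit, ← Finset.smul_sum, ← hsum, lebUnit]

theorem lebUnit_eq_sum_map (M : ℕ) :
    lebUnit = (2 ^ M : ENNReal)⁻¹ • ∑ k ∈ Finset.range (2 ^ M), lebUnit.map (invBranch M k) := by
  rw [← two_pow_smul_lebUnit_eq_sum_map, smul_smul,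
    ENNReal.inv_mul_cancel (by simp) (by finiteness), one_smul]

theorem lebUnit_apply_eq_sum (M : ℕ) {T : Set ℝ} (hT : MeasurableSet T) :
    lebUnit T =
      (2 ^ M : ENNReal)⁻¹ * ∑ k ∈ Finset.range (2 ^ M), lebUnit (invBranch M k ⁻¹' T) := by
  conv_lhs => rw [lebUnit_eq_sum_map M]
  simp only [Measure.smul_apply, Measure.coe_finsetSum, Finset.sum_apply, smul_eq_mul,
    Measure.map_apply (measurable_invBranch M _) hT]

theorem integrable_comp_invBranch {M k : ℕ} (hk : k < 2 ^ M) {g : ℝ → ℝ}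
    (hg : Integrable g lebUnit) : Integrable (g ∘ invBranch M k) lebUnit := by
  have hsum := hg.smul_measure (c := 2 ^ M) (by finiteness)
  rw [two_pow_smul_lebUnit_eq_sum_map] at hsum
  exact (integrable_finsetSum_measure.1 hsum k (Finset.mem_range.2 hk)).comp_measurable
    (measurable_invBranch M k)

theorem integral_lebUnit_eq_sum (M : ℕ) {g : ℝ → ℝ} (hg : Integrable g lebUnit) :
    ∫ x, g x ∂lebUnit =
      (2 ^ M)⁻¹ * ∑ k ∈ Finset.range (2 ^ M), ∫ y, g (invBranch M k y) ∂lebUnit := by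
  have hbranch : ∀ k ∈ Finset.range (2 ^ M), Integrable g (lebUnit.map (invBranch M k)) := by
    rw [← integrable_finsetSum_measure, ← two_pow_smul_lebUnit_eq_sum_map]
    exact hg.smul_measure (by finiteness)
  conv_lhs => rw [lebUnit_eq_sum_map M]
  rw [integral_smul_measure, integral_finsetSum_measure hbranch, ENNReal.toReal_inv,
    ENNReal.toReal_pow, ENNReal.toReal_ofNat, smul_eq_mul]
  congr 1
  exact Finset.sum_congr rfl fun k hk => integral_map (measurable_invBranch M k).aemeasurable
    (hbranch k hk).aestronglyMeasurable

theorem measurePreserving_doublingMap : MeasurePreserving doublingMap lebUnit lebUnit := by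
  refine ⟨measurable_doublingMap, Measure.ext fun s hs => ?_⟩
  rw [Measure.map_apply measurable_doublingMap hs,
    lebUnit_apply_eq_sum 1 (measurable_doublingMap hs)]
  have hbranch : ∀ k ∈ Finset.range (2 ^ 1),
      lebUnit (invBranch 1 k ⁻¹' (doublingMap ⁻¹' s)) = lebUnit s := fun k hk => by
    refine measure_congr (ae_lebUnit_mem_Ico.mono fun y hy => ?_)
    exact congrArg (· ∈ s) (iterate_invBranch (Finset.mem_range.1 hk) hy)
  rw [Finset.sum_congr rfl hbranch, Finset.sum_const, Finset.card_range, nsmul_eq_mul, ← mul_assoc]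
  norm_num [ENNReal.inv_mul_cancel]

/-- The transfer operator of the `j`-th iterate of the doubling map with respect to Lebesgue
measure: the average over the `2 ^ j` preimages. -/
noncomputable def transferOp (j : ℕ) (φ : ℝ → ℝ) (y : ℝ) : ℝ :=
  (2 ^ j)⁻¹ * ∑ k ∈ Finset.range (2 ^ j), φ (invBranch j k y)

theorem integrable_transferOp (j : ℕ) {φ : ℝ → ℝ} (hφ : Integrable φ lebUnit) :
    Integrable (transferOp j φ) lebUnit :=
  (integrable_finsetSum _ fun _ hk =>
    integrable_comp_invBranch (Finset.mem_range.1 hk) hφ).const_mul _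

theorem integral_mul_comp_iterate (j : ℕ) {φ₁ φ₂ : ℝ → ℝ}
    (h : Integrable (fun x => φ₁ x * φ₂ (doublingMap^[j] x)) lebUnit) :
    ∫ x, φ₁ x * φ₂ (doublingMap^[j] x) ∂lebUnit = ∫ y, transferOp j φ₁ y * φ₂ y ∂lebUnit := by
  have hbranch : ∀ k ∈ Finset.range (2 ^ j),
      (fun y => φ₁ (invBranch j k y) * φ₂ (doublingMap^[j] (invBranch j k y))) =ᵐ[lebUnit]
        fun y => φ₁ (invBranch j k y) * φ₂ y := fun k hk =>
    ae_lebUnit_mem_Ico.mono fun y hy => by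
      simp only [iterate_invBranch (Finset.mem_range.1 hk) hy]
  rw [integral_lebUnit_eq_sum j h,
    Finset.sum_congr rfl fun k hk => integral_congr_ae (hbranch k hk),
    ← integral_finsetSum _ fun k hk => (integrable_comp_invBranch (Finset.mem_range.1 hk) h).congr
      (hbranch k hk), ← integral_const_mul]
  simp only [transferOp, mul_assoc, Finset.sum_mul]

theorem integral_transferOp (j : ℕ) {φ : ℝ → ℝ} (hφ : Integrable φ lebUnit) :
    ∫ y, transferOp j φ y ∂lebUnit = ∫ x, φ x ∂lebUnit := by
  simpa using (integral_mul_comp_iterate j (φ₂ := fun _ => 1) (by simpa using hφ)).symm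

theorem abs_transferOp_sub_transferOp_le (j : ℕ) {φ : ℝ → ℝ} (hφ : bvNorm (Set.Ico 0 1) φ < ⊤)
    {y z : ℝ} (hy : y ∈ Set.Ico (0 : ℝ) 1) (hz : z ∈ Set.Ico (0 : ℝ) 1) :
    |transferOp j φ y - transferOp j φ z| ≤ (2 ^ j)⁻¹ * (bvNorm (Set.Ico 0 1) φ).toReal := by
  have hvar := sum_edist_le_eVariationOn φ (monotone_natCast_div_two_pow j)
    (fun k => invBranch_mem_Ico_iff.2 hy) (fun k => invBranch_mem_Ico_iff.2 hz) (2 ^ j)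
  simp only [Nat.cast_zero, zero_div, Nat.cast_pow, Nat.cast_ofNat, edist_dist, Real.dist_eq,
    div_self (pow_ne_zero j (two_ne_zero (α := ℝ))),
    ← ENNReal.ofReal_sum_of_nonneg fun _ _ => abs_nonneg _] at hvar
  rw [transferOp, transferOp, ← mul_sub, ← Finset.sum_sub_distrib, abs_mul,
    abs_of_pos (by positivity)]
  gcongr
  exact (Finset.abs_sum_le_sum_abs _ _).trans
    ((ENNReal.ofReal_le_iff_le_toReal hφ.ne).1 (hvar.trans le_self_add))

theorem abs_transferOp_sub_integral_le (j : ℕ) {φ : ℝ → ℝ} (hφ : bvNorm (Set.Ico 0 1) φ < ⊤)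
    {y : ℝ} (hy : y ∈ Set.Ico (0 : ℝ) 1) :
    |transferOp j φ y - ∫ x, φ x ∂lebUnit| ≤ (2 ^ j)⁻¹ * (bvNorm (Set.Ico 0 1) φ).toReal := by
  have hint : Integrable φ lebUnit :=
    integrableOn_of_bvNorm_lt_top measurableSet_Ico (by simp) hφ
  have havg : transferOp j φ y - ∫ x, φ x ∂lebUnit =
      ∫ z, (transferOp j φ y - transferOp j φ z) ∂lebUnit := by
    rw [integral_sub (integrable_const _) (integrable_transferOp j hint),
      integral_transferOp j hint]
    simp
  have hosc : ∀ᵐ z ∂lebUnit, ‖transferOp j φ y - transferOp j φ z‖ ≤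
      (2 ^ j)⁻¹ * (bvNorm (Set.Ico 0 1) φ).toReal :=
    ae_lebUnit_mem_Ico.mono fun z hz => abs_transferOp_sub_transferOp_le j hφ hy hz
  rw [havg]
  simpa using norm_integral_le_of_norm_le_const hosc

theorem hasExpDecayBVL1_doublingMap : HasExpDecayBVL1 (Set.Ico 0 1) doublingMap lebUnit := by
  refine ⟨1, 1 / 2, one_pos, by norm_num, by norm_num, fun φ₁ φ₂ h₁ h₂ j => ?_⟩
  have hint : Integrable φ₁ lebUnit :=
    integrableOn_of_bvNorm_lt_top measurableSet_Ico (by simp) h₁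
  have hcomp : Integrable (fun x => φ₁ x * φ₂ (doublingMap^[j] x)) lebUnit :=
    ((measurePreserving_doublingMap.iterate j).integrable_comp_of_integrable h₂).bdd_mul
      hint.aestronglyMeasurable (ae_lebUnit_mem_Ico.mono fun x hx => abs_le_toReal_bvNorm h₁ hx)
  have hbound : ∀ᵐ y ∂lebUnit, ‖transferOp j φ₁ y - ∫ x, φ₁ x ∂lebUnit‖ ≤
      (2 ^ j)⁻¹ * (bvNorm (Set.Ico 0 1) φ₁).toReal :=
    ae_lebUnit_mem_Ico.mono fun y hy => abs_transferOp_sub_integral_le j h₁ hy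
  have hprod : Integrable (fun y => (transferOp j φ₁ y - ∫ x, φ₁ x ∂lebUnit) * φ₂ y) lebUnit :=
    h₂.bdd_mul ((integrable_transferOp j hint).sub (integrable_const _)).aestronglyMeasurable hbound
  have hcorr : (∫ x, φ₁ x * φ₂ (doublingMap^[j] x) ∂lebUnit) -
      (∫ x, φ₁ x ∂lebUnit) * ∫ x, φ₂ x ∂lebUnit =
        ∫ y, (transferOp j φ₁ y - ∫ x, φ₁ x ∂lebUnit) * φ₂ y ∂lebUnit := by
    rw [integral_mul_comp_iterate j hcomp, ← integral_const_mul, sub_eq_iff_eq_add,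
      ← integral_add hprod (h₂.const_mul _)]
    simp only [sub_mul, sub_add_cancel]
  rw [hcorr, one_mul, one_div, inv_pow, ← integral_const_mul, ← Real.norm_eq_abs]
  refine norm_integral_le_of_norm_le (h₂.abs.const_mul _) (hbound.mono fun y hy => ?_)
  rw [norm_mul]
  exact mul_le_mul_of_nonneg_right hy (abs_nonneg _)

theorem measurableSet_returnSet {X : Set ℝ} {f : ℝ → ℝ} (hX : MeasurableSet X) (hf : Measurable f)
    (j : ℕ) (r : ℝ) : MeasurableSet (returnSet X f j r) :=
  hX.inter (measurableSet_le (measurable_id.dist (hf.iterate j)) measurable_const)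

theorem lebUnit_preimage_invBranch_returnSet_le {j k : ℕ} (hj : 1 ≤ j) (hk : k < 2 ^ j) {r : ℝ}
    (hr : 0 ≤ r) :
    lebUnit (invBranch j k ⁻¹' returnSet (Set.Ico 0 1) doublingMap j r) ≤
      ENNReal.ofReal (4 * r) := by
  have h2 : (2 : ℝ) ≤ 2 ^ j := le_self_pow₀ one_le_two (by omega)
  have hpos : (0 : ℝ) < 2 ^ j - 1 := by linarith
  have hsub : invBranch j k ⁻¹' returnSet (Set.Ico 0 1) doublingMap j r ≤ᵐ[lebUnit]
      Set.Icc ((k - 2 ^ j * r) / (2 ^ j - 1)) ((k + 2 ^ j * r) / (2 ^ j - 1)) := by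
    filter_upwards [ae_lebUnit_mem_Ico] with y hy hmem
    have hdist := hmem.2
    rw [iterate_invBranch hk hy, Real.dist_eq, abs_le] at hdist
    have hy_eq := two_pow_mul_invBranch j k y
    refine ⟨(div_le_iff₀ hpos).2 ?_, (le_div_iff₀ hpos).2 ?_⟩ <;> nlinarith
  calc lebUnit (invBranch j k ⁻¹' returnSet (Set.Ico 0 1) doublingMap j r)
      ≤ lebUnit (Set.Icc ((k - 2 ^ j * r) / (2 ^ j - 1)) ((k + 2 ^ j * r) / (2 ^ j - 1))) :=
        measure_mono_ae hsub
    _ ≤ ENNReal.ofReal ((k + 2 ^ j * r) / (2 ^ j - 1) - (k - 2 ^ j * r) / (2 ^ j - 1)) :=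
        (Measure.restrict_apply_le _ _).trans_eq Real.volume_Icc
    _ ≤ ENNReal.ofReal (4 * r) := by
        refine ENNReal.ofReal_le_ofReal ?_
        rw [← sub_div, div_le_iff₀ hpos]
        nlinarith

theorem measureReal_returnSet_le {j : ℕ} (hj : 1 ≤ j) {r : ℝ} (hr : 0 ≤ r) :
    lebUnit.real (returnSet (Set.Ico 0 1) doublingMap j r) ≤ 4 * r := by
  refine ENNReal.toReal_le_of_le_ofReal (by positivity) ?_
  rw [lebUnit_apply_eq_sum j (measurableSet_returnSet measurableSet_Ico measurable_doublingMap j r)]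
  calc (2 ^ j : ENNReal)⁻¹ * ∑ k ∈ Finset.range (2 ^ j),
        lebUnit (invBranch j k ⁻¹' returnSet (Set.Ico 0 1) doublingMap j r)
      ≤ (2 ^ j : ENNReal)⁻¹ * ∑ k ∈ Finset.range (2 ^ j), ENNReal.ofReal (4 * r) := by
        gcongr with k hk
        exact lebUnit_preimage_invBranch_returnSet_le hj (Finset.mem_range.1 hk) hr
    _ = ENNReal.ofReal (4 * r) := by
        rw [Finset.sum_const, Finset.card_range, nsmul_eq_mul, ← mul_assoc]
        push_cast
        rw [ENNReal.inv_mul_cancel (by simp) (by finiteness), one_mul]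

theorem isHyperbolicRecurrent_doublingMap :
    IsHyperbolicRecurrent (Set.Ico 0 1) doublingMap lebUnit (fun _ => 1) where
  ordConnected := Set.ordConnected_Ico
  mapsTo := mapsTo_doublingMap
  isProbabilityMeasure := inferInstance
  ergodic := hasExpDecayBVL1_doublingMap.ergodic measurePreserving_doublingMap
  density_nonneg _ _ := zero_le_one
  density := by simp [lebUnit]
  density_bv := bvNorm_lt_top_of_monotoneOn monotoneOn_const (a := 1) (b := 1)
    fun _ _ => ⟨le_rfl, le_rfl⟩
  decay := hasExpDecayBVL1_doublingMap
  short_returns := hasFewShortReturns_of_measureReal_returnSet_le_mul four_pos fun _ hj _ hr =>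
    measureReal_returnSet_le hj hr

end DoublingMap

/-! ### Dyadic intervals -/

section Dyadic

/-- The `σ`-algebra on `ℝ` generated by the dyadic intervals of length `2⁻ᴾ`; on `[0,1)` it carries
the information of the first `P` binary digits. -/
noncomputable abbrev dyadicAlgebra (P : ℕ) : MeasurableSpace ℝ := .comap (fun x => ⌊2 ^ P * x⌋) ⊤

theorem dyadicAlgebra_le (P : ℕ) : dyadicAlgebra P ≤ borel ℝ :=
  (Int.measurable_floor.comp (measurable_const_mul (2 ^ P))).comap_le

theorem floor_two_pow_mul_eq_ediv (P j : ℕ) (x : ℝ) :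
    ⌊2 ^ P * x⌋ = ⌊2 ^ (P + j) * x⌋ / 2 ^ j := by
  have h := Int.floor_div_natCast (2 ^ (P + j) * x) (2 ^ j)
  rw [Nat.cast_pow, Nat.cast_ofNat, pow_add, mul_right_comm,
    mul_div_cancel_right₀ _ (by positivity)] at h
  rw [h, pow_add, mul_right_comm]
  norm_cast

theorem dyadicAlgebra_mono : Monotone dyadicAlgebra := fun P Q h => by
  obtain ⟨j, rfl⟩ := Nat.exists_eq_add_of_le h
  have hcomp : (fun x : ℝ => ⌊2 ^ P * x⌋) = (· / 2 ^ j) ∘ fun x : ℝ => ⌊2 ^ (P + j) * x⌋ :=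
    funext (floor_two_pow_mul_eq_ediv P j)
  rw [dyadicAlgebra, hcomp, ← MeasurableSpace.comap_comp]
  exact MeasurableSpace.comap_mono le_top

theorem floor_two_pow_mul_doublingMap (P : ℕ) (x : ℝ) :
    ⌊2 ^ P * doublingMap x⌋ = ⌊2 ^ (P + 1) * x⌋ % 2 ^ P := by
  have hdiv : ⌊2 * x⌋ = ⌊2 ^ (P + 1) * x⌋ / 2 ^ P := by
    simpa [add_comm] using floor_two_pow_mul_eq_ediv 1 P x
  have hmul : (2 : ℝ) ^ P * doublingMap x = 2 ^ (P + 1) * x - (2 ^ P * ⌊2 * x⌋ : ℤ) := by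
    rw [doublingMap, Int.fract]
    push_cast
    ring
  rw [hmul, Int.floor_sub_intCast, hdiv, Int.emod_def]

theorem measurable_doublingMap_dyadicAlgebra (P : ℕ) :
    Measurable[dyadicAlgebra (P + 1), dyadicAlgebra P] doublingMap := by
  have hcomp : (fun x : ℝ => ⌊2 ^ P * x⌋) ∘ doublingMap =
      (· % 2 ^ P) ∘ fun x : ℝ => ⌊2 ^ (P + 1) * x⌋ := funext (floor_two_pow_mul_doublingMap P)
  rw [measurable_iff_comap_le, dyadicAlgebra, MeasurableSpace.comap_comp, hcomp,
    ← MeasurableSpace.comap_comp]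
  exact MeasurableSpace.comap_mono le_top

theorem measurable_iterate_doublingMap_dyadicAlgebra (P j : ℕ) :
    Measurable[dyadicAlgebra (j + P), dyadicAlgebra P] doublingMap^[j] := by
  induction j with
  | zero =>
    rw [zero_add]
    exact measurable_id
  | succ j ih =>
    rw [add_right_comm]
    exact ih.comp (measurable_doublingMap_dyadicAlgebra (j + P))

theorem measureReal_inter_preimage_iterate {P : ℕ} {D A : Set ℝ}
    (hD : MeasurableSet[dyadicAlgebra P] D) (hA : MeasurableSet A) :
    lebUnit.real (D ∩ doublingMap^[P] ⁻¹' A) = lebUnit.real D * lebUnit.real A := by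
  have hprod : ∃ c : ENNReal, ∀ A, MeasurableSet A →
      lebUnit (D ∩ doublingMap^[P] ⁻¹' A) = c * lebUnit A := by
    have hDm := dyadicAlgebra_le P _ hD
    obtain ⟨T, -, rfl⟩ := hD
    refine ⟨(2 ^ P)⁻¹ * ∑ k ∈ Finset.range (2 ^ P), T.indicator 1 (k : ℤ), fun A hA => ?_⟩
    rw [lebUnit_apply_eq_sum P (hDm.inter (measurable_doublingMap.iterate P hA)), mul_assoc,
      Finset.sum_mul]
    congr 1
    refine Finset.sum_congr rfl fun k hk => ?_
    have hbranch : invBranch P k ⁻¹' ((fun x => ⌊2 ^ P * x⌋) ⁻¹' T ∩ doublingMap^[P] ⁻¹' A)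
        =ᵐ[lebUnit] ({_y : ℝ | (k : ℤ) ∈ T} ∩ A : Set ℝ) :=
      ae_lebUnit_mem_Ico.mono fun y hy => by
        change (⌊2 ^ P * invBranch P k y⌋ ∈ T ∧ doublingMap^[P] (invBranch P k y) ∈ A) =
          ((k : ℤ) ∈ T ∧ y ∈ A)
        rw [two_pow_mul_invBranch, Int.floor_add_natCast, Int.floor_eq_zero_iff.2 hy, zero_add,
          iterate_invBranch (Finset.mem_range.1 hk) hy]
    rw [measure_congr hbranch]
    by_cases hkT : (k : ℤ) ∈ T <;> simp [hkT]
  obtain ⟨c, hc⟩ := hprod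
  have huniv := hc Set.univ .univ
  rw [Set.preimage_univ, Set.inter_univ, measure_univ, mul_one] at huniv
  rw [measureReal_def, hc A hA, ← huniv, ENNReal.toReal_mul, measureReal_def, measureReal_def]

/-- The union of the dyadic intervals of length `2⁻ᴹ` whose index is at distance at most `m` from
`a`. In particular `dyadicNhd M 0 a` is the `a`-th dyadic interval. -/
def dyadicNhd (M m a : ℕ) : Set ℝ := Set.Ico (((a : ℝ) - m) / 2 ^ M) ((a + m + 1) / 2 ^ M)

theorem mem_dyadicNhd_iff_floor {M m a : ℕ} {x : ℝ} :
    x ∈ dyadicNhd M m a ↔ ⌊2 ^ M * x⌋ ∈ Set.Icc (a - m : ℤ) (a + m) := by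
  have h2 : (0 : ℝ) < 2 ^ M := by positivity
  rw [dyadicNhd, Set.mem_Ico, div_le_iff₀' h2, lt_div_iff₀' h2, Set.mem_Icc, Int.le_floor,
    ← Int.lt_add_one_iff, Int.floor_lt]
  push_cast
  rfl

theorem measurableSet_dyadicNhd_dyadicAlgebra (M m a : ℕ) :
    MeasurableSet[dyadicAlgebra M] (dyadicNhd M m a) :=
  ⟨Set.Icc (a - m) (a + m), trivial, Set.ext fun _ => mem_dyadicNhd_iff_floor.symm⟩

theorem dist_lt_of_mem_dyadicNhd {M m m' a : ℕ} {x y : ℝ} (hx : x ∈ dyadicNhd M m a)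
    (hy : y ∈ dyadicNhd M m' a) : dist x y < (m + m' + 1) / 2 ^ M := by
  rw [Real.dist_eq, abs_sub_lt_iff]
  constructor
  · calc x - y < (a + m + 1) / 2 ^ M - ((a : ℝ) - m') / 2 ^ M := by
          linarith [hx.2, hy.1]
      _ = (m + m' + 1) / 2 ^ M := by ring
  · calc y - x < (a + m' + 1) / 2 ^ M - ((a : ℝ) - m) / 2 ^ M := by
          linarith [hy.2, hx.1]
      _ = (m + m' + 1) / 2 ^ M := by ring

theorem measureReal_dyadicNhd {M m a : ℕ} (hma : m ≤ a) (ham : a + m < 2 ^ M) :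
    lebUnit.real (dyadicNhd M m a) = (2 * m + 1) / 2 ^ M := by
  have h2 : (0 : ℝ) < 2 ^ M := by positivity
  have hma' : (m : ℝ) ≤ a := by exact_mod_cast hma
  have ham' : (a : ℝ) + m + 1 ≤ 2 ^ M := by exact_mod_cast ham
  have hsub : dyadicNhd M m a ⊆ Set.Ico 0 1 :=
    Set.Ico_subset_Ico (div_nonneg (sub_nonneg.2 hma') h2.le) ((div_le_one h2).2 ham')
  rw [lebUnit, measureReal_restrict_apply' measurableSet_Ico, Set.inter_eq_left.2 hsub, dyadicNhd,
    Real.volume_real_Ico_of_le (by gcongr; linarith)]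
  ring

theorem ae_exists_mem_dyadicNhd_zero (M : ℕ) :
    ∀ᵐ x ∂lebUnit, ∃ a < 2 ^ M, x ∈ dyadicNhd M 0 a := by
  filter_upwards [ae_lebUnit_mem_Ico] with x hx
  have h2 : (0 : ℝ) < 2 ^ M := by positivity
  have h0 : 0 ≤ 2 ^ M * x := mul_nonneg h2.le hx.1
  refine ⟨⌊2 ^ M * x⌋₊, ?_, ?_⟩
  · rw [Nat.floor_lt h0]
    push_cast
    exact mul_lt_of_lt_one_right h2 hx.2
  · rw [mem_dyadicNhd_iff_floor, Int.natCast_floor_eq_floor h0]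
    simp

theorem measureReal_le_sum_inter_dyadicNhd (M : ℕ) (E : Set ℝ) :
    lebUnit.real E ≤ ∑ a ∈ Finset.range (2 ^ M), lebUnit.real (E ∩ dyadicNhd M 0 a) := by
  refine (ENNReal.toReal_mono (measure_ne_top _ _) (measure_mono_ae ?_)).trans
    (measureReal_biUnion_finset_le _ _)
  filter_upwards [ae_exists_mem_dyadicNhd_zero M] with x ⟨a, ha, hxa⟩ hx
  exact Set.mem_biUnion (Finset.mem_coe.2 (Finset.mem_range.2 ha)) ⟨hx, hxa⟩

open Classical in
theorem card_filter_mem_dyadicNhd_le (M m : ℕ) (s : Finset ℕ) (x : ℝ) :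
    (s.filter fun a => x ∈ dyadicNhd M m a).card ≤ 2 * m + 1 := by
  have hcard : (Finset.Icc (⌊2 ^ M * x⌋ - m) (⌊2 ^ M * x⌋ + m)).card = 2 * m + 1 := by
    rw [Int.card_Icc]
    omega
  rw [← hcard]
  refine Finset.card_le_card_of_injOn Nat.cast (fun a ha => ?_) Nat.cast_injective.injOn
  have hmem := mem_dyadicNhd_iff_floor.1 (Finset.mem_filter.1 ha).2
  simp only [Finset.coe_Icc, Set.mem_Icc] at hmem ⊢
  omega

theorem card_filter_boundary_le (N m : ℕ) :
    ((Finset.range N).filter fun a => ¬ (m ≤ a ∧ a + m < N)).card ≤ 2 * m := by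
  calc ((Finset.range N).filter fun a => ¬ (m ≤ a ∧ a + m < N)).card
      ≤ (Finset.range m ∪ Finset.Ico (N - m) N).card := by
        refine Finset.card_le_card fun a ha => ?_
        simp only [Finset.mem_filter, Finset.mem_range, Finset.mem_union, Finset.mem_Ico] at ha ⊢
        omega
    _ ≤ m + (N - (N - m)) := by
        refine (Finset.card_union_le _ _).trans ?_
        rw [Finset.card_range, Nat.card_Ico]
    _ ≤ 2 * m := by omega

theorem sum_returnSum_dyadicNhd_le (M m L : ℕ) :
    ∑ a ∈ Finset.range (2 ^ M), returnSum doublingMap lebUnit L (dyadicNhd M m a) ≤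
      L * ((2 * m + 1) * (4 * ((2 * m + 1) / 2 ^ M))) := by
  classical
  simp only [returnSum]
  rw [Finset.sum_comm, ← nsmul_eq_mul, ← Finset.card_range L, ← Finset.sum_const, Finset.card_range]
  refine Finset.sum_le_sum fun j _ => ?_
  set R := returnSet (Set.Ico 0 1) doublingMap (j + 1) ((2 * m + 1) / 2 ^ M)
  calc ∑ a ∈ Finset.range (2 ^ M),
        lebUnit.real (dyadicNhd M m a ∩ doublingMap^[j + 1] ⁻¹' dyadicNhd M m a)
      ≤ ∑ a ∈ Finset.range (2 ^ M), lebUnit.real (dyadicNhd M m a ∩ R) := by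
        refine Finset.sum_le_sum fun a _ =>
          ENNReal.toReal_mono (measure_ne_top _ _) (measure_mono_ae ?_)
        filter_upwards [ae_lebUnit_mem_Ico] with x hx hxa
        have hdist := dist_lt_of_mem_dyadicNhd hxa.1 hxa.2
        exact ⟨hxa.1, hx, by rw [two_mul]; exact hdist.le⟩
    _ ≤ (2 * m + 1 : ℕ) * lebUnit.real R :=
        sum_measureReal_inter_le_mul (A := dyadicNhd M m) (fun _ => measurableSet_Ico)
          (card_filter_mem_dyadicNhd_le M m _) R
    _ ≤ (2 * m + 1) * (4 * ((2 * m + 1) / 2 ^ M)) := by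
        push_cast
        gcongr
        exact measureReal_returnSet_le j.succ_pos (by positivity)

end Dyadic

/-! ### Points without a close return -/

section NoCloseReturn

theorem measureReal_forall_iterate_notMem_le {M : ℕ} {B : Set ℝ}
    (hB : MeasurableSet[dyadicAlgebra M] B) (L q : ℕ) :
    lebUnit.real {x | ∀ i < q * (L + M), doublingMap^[i] x ∉ B} ≤
      Real.exp (-(q * L * (lebUnit.real B - returnSum doublingMap lebUnit L B))) := by
  set D := {x | ∀ i < L, doublingMap^[i] x ∉ B} with hD_def
  have hD : MeasurableSet[dyadicAlgebra (L + M)] D := by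
    simp only [hD_def, Set.ofPred_forall]
    refine .iInter fun i => .iInter fun hi => dyadicAlgebra_mono (by omega : i + M ≤ L + M) _ ?_
    exact measurable_iterate_doublingMap_dyadicAlgebra M i hB.compl
  have hD_le : lebUnit.real D ≤
      Real.exp (-(L * (lebUnit.real B - returnSum doublingMap lebUnit L B))) := by
    have hcompl : Dᶜ = {x | ∃ i < L, doublingMap^[i] x ∈ B} := by
      ext x
      simp [hD_def]
    have hhit := mul_sub_returnSum_le_measureReal_exists measurePreserving_doublingMap
      (dyadicAlgebra_le M _ hB) L
    rw [← hcompl, probReal_compl_eq_one_sub (dyadicAlgebra_le _ _ hD)] at hhit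
    refine le_trans ?_ (Real.add_one_le_exp _)
    linarith
  calc lebUnit.real {x | ∀ i < q * (L + M), doublingMap^[i] x ∉ B}
      ≤ lebUnit.real {x | ∀ t < q, (doublingMap^[L + M])^[t] x ∈ D} := by
        refine measureReal_mono fun x hx t ht i hi => ?_
        rw [← Function.iterate_mul, ← Function.iterate_add_apply]
        refine hx _ ?_
        calc i + (L + M) * t < (L + M) * (t + 1) := by rw [mul_add]; omega
          _ ≤ q * (L + M) := by rw [mul_comm q]; exact Nat.mul_le_mul_left _ ht
    _ = lebUnit.real D ^ q :=
        measureReal_forall_iterate_mem (measurable_doublingMap.iterate _)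
          (dyadicAlgebra_le _ _ hD) (fun _ hA => measureReal_inter_preimage_iterate hD hA) q
    _ ≤ _ := pow_le_pow_left₀ measureReal_nonneg hD_le q
    _ = _ := by
        rw [← Real.exp_nat_mul]
        ring_nf

theorem measureReal_noReturnSet_inter_dyadicNhd_le {M m L q n a : ℕ} (hM : 1 ≤ M)
    (hn : M + q * (L + M) ≤ n) (ha : a < 2 ^ M) :
    lebUnit.real (noReturnSet doublingMap n ((m + 1) / 2 ^ M) ∩ dyadicNhd M 0 a) ≤
      (2 ^ M)⁻¹ * Real.exp (-(q * L * (lebUnit.real (dyadicNhd M m a) -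
        returnSum doublingMap lebUnit L (dyadicNhd M m a)))) := by
  set G := {x | ∀ i < q * (L + M), doublingMap^[i] x ∉ dyadicNhd M m a} with hG_def
  have hG : MeasurableSet G := by
    simp only [hG_def, Set.ofPred_forall]
    exact .iInter fun i => .iInter fun _ =>
      measurable_doublingMap.iterate i measurableSet_Ico.compl
  calc lebUnit.real (noReturnSet doublingMap n ((m + 1) / 2 ^ M) ∩ dyadicNhd M 0 a)
      ≤ lebUnit.real (dyadicNhd M 0 a ∩ doublingMap^[M] ⁻¹' G) := by
        refine measureReal_mono fun x ⟨hx, hxa⟩ => ⟨hxa, fun i hi hmem => ?_⟩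
        rw [← Function.iterate_add_apply] at hmem
        have hdist := dist_lt_of_mem_dyadicNhd hmem hxa
        rw [Nat.cast_zero, add_zero] at hdist
        exact hdist.not_ge (hx _ (by omega) (by omega))
    _ = lebUnit.real (dyadicNhd M 0 a) * lebUnit.real G :=
        measureReal_inter_preimage_iterate (measurableSet_dyadicNhd_dyadicAlgebra M 0 a) hG
    _ ≤ _ := by
        rw [measureReal_dyadicNhd a.zero_le ha, Nat.cast_zero, mul_zero, zero_add, one_div]
        gcongr
        exact measureReal_forall_iterate_notMem_le (measurableSet_dyadicNhd_dyadicAlgebra M m a) L q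

/-- Summed over `a`, the second term counts the intervals too close to an endpoint of `[0,1)`, and
the third one counts, by Markov's inequality, those with a large return sum. -/
theorem measureReal_noReturnSet_inter_dyadicNhd_le_add {M m L q n a : ℕ} (hM : 1 ≤ M)
    (hn : M + q * (L + M) ≤ n) {ε : ℝ} (hε : 0 < ε) (ha : a < 2 ^ M) :
    lebUnit.real (noReturnSet doublingMap n ((m + 1) / 2 ^ M) ∩ dyadicNhd M 0 a) ≤
      (2 ^ M)⁻¹ * (Real.exp (-(q * L * ((1 - ε) * ((2 * m + 1) / 2 ^ M)))) +
        (if ¬ (m ≤ a ∧ a + m < 2 ^ M) then 1 else 0) +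
        returnSum doublingMap lebUnit L (dyadicNhd M m a) / (ε * ((2 * m + 1) / 2 ^ M))) := by
  have hRS : 0 ≤ returnSum doublingMap lebUnit L (dyadicNhd M m a) := returnSum_nonneg ..
  have htriv : lebUnit.real (noReturnSet doublingMap n ((m + 1) / 2 ^ M) ∩ dyadicNhd M 0 a) ≤
      (2 ^ M)⁻¹ * 1 := by
    refine (measureReal_mono Set.inter_subset_right).trans_eq ?_
    rw [measureReal_dyadicNhd a.zero_le ha, Nat.cast_zero, mul_zero, zero_add, one_div, mul_one]
  by_cases hint : m ≤ a ∧ a + m < 2 ^ M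
  · rw [if_neg (not_not.2 hint), add_zero]
    rcases le_or_gt (returnSum doublingMap lebUnit L (dyadicNhd M m a))
      (ε * ((2 * m + 1) / 2 ^ M)) with hsmall | hlarge
    · refine (measureReal_noReturnSet_inter_dyadicNhd_le hM hn ha).trans ?_
      rw [measureReal_dyadicNhd hint.1 hint.2]
      gcongr
      refine le_add_of_le_of_nonneg (Real.exp_le_exp.2 (neg_le_neg ?_)) (by positivity)
      gcongr
      linarith
    · refine htriv.trans ?_
      gcongr
      exact le_add_of_nonneg_of_le (by positivity) ((one_le_div (by positivity)).2 hlarge.le)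
  · refine htriv.trans ?_
    rw [if_pos hint, add_assoc]
    gcongr
    exact le_add_of_nonneg_of_le (by positivity) (le_add_of_nonneg_right (by positivity))

theorem measureReal_noReturnSet_dyadic_le {M L q n : ℕ} (m : ℕ) (hM : 1 ≤ M)
    (hn : M + q * (L + M) ≤ n) {ε : ℝ} (hε : 0 < ε) :
    lebUnit.real (noReturnSet doublingMap n ((m + 1) / 2 ^ M)) ≤
      Real.exp (-(q * L * ((1 - ε) * ((2 * m + 1) / 2 ^ M)))) +
        (1 + 4 * L / ε) * ((2 * m + 1) / 2 ^ M) := by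
  have hcells := (measureReal_le_sum_inter_dyadicNhd M _).trans <| Finset.sum_le_sum fun a ha =>
    measureReal_noReturnSet_inter_dyadicNhd_le_add (m := m) hM hn hε (Finset.mem_range.1 ha)
  rw [← Finset.mul_sum, Finset.sum_add_distrib, Finset.sum_add_distrib, Finset.sum_const,
    Finset.card_range, nsmul_eq_mul, Finset.sum_boole, ← Finset.sum_div, Nat.cast_pow,
    Nat.cast_ofNat] at hcells
  have hboundary : (((Finset.range (2 ^ M)).filter fun a => ¬ (m ≤ a ∧ a + m < 2 ^ M)).card : ℝ) ≤
      2 * m + 1 := by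
    have := card_filter_boundary_le (2 ^ M) m
    exact_mod_cast this.trans (Nat.le_succ _)
  have hreturn := sum_returnSum_dyadicNhd_le M m L
  set X := Real.exp (-(q * L * ((1 - ε) * ((2 * m + 1) / 2 ^ M))))
  calc lebUnit.real (noReturnSet doublingMap n ((m + 1) / 2 ^ M))
      ≤ (2 ^ M)⁻¹ * (2 ^ M * X + (2 * m + 1) +
          L * ((2 * m + 1) * (4 * ((2 * m + 1) / 2 ^ M))) / (ε * ((2 * m + 1) / 2 ^ M))) := by
        refine hcells.trans ?_
        gcongr
    _ = X + (1 + 4 * L / ε) * ((2 * m + 1) / 2 ^ M) := by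
        field_simp
        ring

theorem measureReal_noReturnSet_le {M L q n : ℕ} (hM : 1 ≤ M) (hn : M + q * (L + M) ≤ n)
    {ε : ℝ} (hε : 0 < ε) (hε1 : ε ≤ 1) {r : ℝ} (hr : 0 ≤ r) :
    lebUnit.real (noReturnSet doublingMap n r) ≤
      Real.exp (-(q * L * ((1 - ε) * (2 * r - 3 / 2 ^ M)))) + (1 + 4 * L / ε) * (2 * r) := by
  have h2 : (0 : ℝ) < 2 ^ M := by positivity
  have hε' : 0 ≤ 1 - ε := sub_nonneg.2 hε1
  rcases lt_or_ge (r * 2 ^ M) 1 with hsmall | hlarge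
  · have hneg : 2 * r - 3 / 2 ^ M ≤ 0 := by
      rw [sub_nonpos, le_div_iff₀ h2]
      linarith
    refine measureReal_le_one.trans (le_add_of_le_of_nonneg (Real.one_le_exp ?_) (by positivity))
    exact neg_nonneg.2 (mul_nonpos_of_nonneg_of_nonpos (by positivity)
      (mul_nonpos_of_nonneg_of_nonpos hε' hneg))
  · obtain ⟨m, hm⟩ : ∃ m, ⌊r * 2 ^ M⌋₊ = m + 1 :=
      Nat.exists_eq_add_one.2 (Nat.floor_pos.2 hlarge)
    have hm_le : (m : ℝ) + 1 ≤ r * 2 ^ M := by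
      exact_mod_cast hm ▸ Nat.floor_le (zero_le_one.trans hlarge)
    have hlt_m : r * 2 ^ M < m + 1 + 1 := by
      exact_mod_cast hm ▸ Nat.lt_floor_add_one (r * 2 ^ M)
    have hlower : 2 * r - 3 / 2 ^ M ≤ (2 * m + 1) / 2 ^ M := by
      rw [sub_le_iff_le_add, ← add_div, le_div_iff₀ h2]
      linarith
    have hupper : (2 * m + 1) / 2 ^ M ≤ 2 * r := by
      rw [div_le_iff₀ h2]
      linarith
    refine (measureReal_mono (noReturnSet_anti doublingMap n ((div_le_iff₀ h2).2 hm_le))).trans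
      ((measureReal_noReturnSet_dyadic_le m hM hn hε).trans ?_)
    gcongr

end NoCloseReturn

/-! ### Geometric times -/

section GeometricTimes

variable {c l : ℝ}

/-- The number of blocks of length `k² + k` that fit in between the times `k` and `l ^ k`. -/
noncomputable def blockCount (l : ℝ) (k : ℕ) : ℕ := ⌊(l ^ k - k) / ((k : ℝ) ^ 2 + k)⌋₊

theorem eventually_add_blockCount_mul_le (hl : 1 < l) :
    ∀ᶠ k : ℕ in atTop, k + blockCount l k * (k ^ 2 + k) ≤ ⌈l ^ k⌉₊ := by
  filter_upwards [(tendsto_pow_const_div_const_pow_of_one_lt 1 hl).eventually_lt_const one_pos,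
    eventually_gt_atTop 0] with k hklt hk
  rw [pow_one, div_lt_one (by positivity)] at hklt
  have hfloor : (blockCount l k : ℝ) ≤ (l ^ k - k) / ((k : ℝ) ^ 2 + k) :=
    Nat.floor_le (div_nonneg (sub_nonneg.2 hklt.le) (by positivity))
  rw [le_div_iff₀ (by positivity), le_sub_iff_add_le'] at hfloor
  exact_mod_cast hfloor.trans (Nat.le_ceil _)

theorem eventually_pow_le_mul_blockCount_mul (hl : 1 < l) :
    ∀ᶠ k : ℕ in atTop, l ^ k ≤ l * (blockCount l k * (k : ℝ) ^ 2) := by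
  have hl0 : 0 < l := one_pos.trans hl
  have hlim : Tendsto (fun k : ℕ => ((l ^ k - k) / ((k : ℝ) ^ 2 + k) - 1) * k ^ 2 / l ^ k)
      atTop (𝓝 1) := by
    have h := (((tendsto_pow_const_div_const_pow_of_one_lt 1 hl).const_sub 1).mul
      (tendsto_natCast_div_add_atTop (1 : ℝ))).sub (tendsto_pow_const_div_const_pow_of_one_lt 2 hl)
    rw [sub_zero, mul_one, sub_zero] at h
    refine h.congr' ?_
    filter_upwards [eventually_gt_atTop 0] with k hk
    field_simp
  filter_upwards [hlim.eventually_const_lt (inv_lt_one_of_one_lt₀ hl)] with k hk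
  rw [lt_div_iff₀ (by positivity), inv_mul_lt_iff₀ hl0] at hk
  refine hk.le.trans ?_
  gcongr
  exact (Nat.sub_one_lt_floor _).le

/-- A lower bound for `c log log n / n` in the range `l ^ k ≤ n < l ^ (k + 1)`, obtained by taking
`n = l ^ k` in the numerator and `n = l ^ (k + 1)` in the denominator. -/
noncomputable def geomThreshold (c l : ℝ) (k : ℕ) : ℝ := c * Real.log (k * Real.log l) / l ^ (k + 1)

theorem eventually_geomThreshold_nonneg (hc : 0 ≤ c) (hl : 1 < l) :
    ∀ᶠ k : ℕ in atTop, 0 ≤ geomThreshold c l k := by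
  have hlim := tendsto_natCast_atTop_atTop (R := ℝ).atTop_mul_const (Real.log_pos hl)
  filter_upwards [hlim.eventually_ge_atTop 1] with k hk
  have hlog := Real.log_nonneg hk
  rw [geomThreshold]
  positivity

theorem geomThreshold_le (hc : 0 ≤ c) (hl : 1 < l) (k : ℕ) :
    geomThreshold c l k ≤ c * Real.log l / l * (k * l⁻¹ ^ k) := by
  have hlog : 0 < Real.log l := Real.log_pos hl
  calc geomThreshold c l k ≤ c * (k * Real.log l) / l ^ (k + 1) := by
        rw [geomThreshold]
        gcongr
        exact Real.log_le_self (by positivity)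
    _ = c * Real.log l / l * (k * l⁻¹ ^ k) := by
        rw [inv_pow, pow_succ]
        field_simp

theorem geomThreshold_le_div (hc : 0 < c) (hl : 1 < l) {k n : ℕ} (hk : 0 < k)
    (hnonneg : 0 ≤ geomThreshold c l k) (hkn : l ^ k ≤ n) (hnk : n < l ^ (k + 1)) :
    geomThreshold c l k ≤ c * Real.log (Real.log n) / n := by
  have hlog : 0 < Real.log l := Real.log_pos hl
  have hn : (0 : ℝ) < n := lt_of_lt_of_le (by positivity) hkn
  have hmul_le : k * Real.log l ≤ Real.log n := by
    rw [← Real.log_pow]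
    gcongr
  have hle : c * Real.log (k * Real.log l) ≤ c * Real.log (Real.log n) := by gcongr
  rw [geomThreshold, le_div_iff₀ (by positivity), zero_mul] at hnonneg
  exact div_le_div₀ (hnonneg.trans hle) hle hn hnk.le

theorem eventually_mul_log_div_pow_le (hc : 0 < c) (hl : 1 < l) (hl2 : l < 2) :
    ∀ᶠ k : ℕ in atTop,
      2 * c / l ^ 2 * (Real.log k / l ^ k) ≤ 2 * geomThreshold c l k - 3 / 2 ^ k := by
  have : 0 < l := one_pos.trans hl
  have hlim : Tendsto (fun k : ℕ => (2 * geomThreshold c l k - 3 / 2 ^ k) / (Real.log k / l ^ k))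
      atTop (𝓝 (2 * c / l)) := by
    have hlog := Real.tendsto_log_atTop.comp (tendsto_natCast_atTop_atTop (R := ℝ))
    have hpow : Tendsto (fun k : ℕ => (l / 2) ^ k) atTop (𝓝 0) :=
      tendsto_pow_atTop_nhds_zero_of_lt_one (by positivity) (by linarith)
    have h := (((hlog.const_div_atTop (Real.log (Real.log l))).const_add 1).const_mul
      (2 * c / l)).sub ((hlog.const_div_atTop 3).mul hpow)
    rw [add_zero, mul_one, mul_zero, sub_zero] at h
    refine h.congr' ?_
    filter_upwards [eventually_gt_atTop 1] with k hk
    have hlogk : 0 < Real.log k := Real.log_pos (by exact_mod_cast hk)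
    rw [geomThreshold, Real.log_mul (by positivity) (Real.log_pos hl).ne', div_pow, pow_succ,
      Function.comp_apply]
    field_simp
  have hlt : 2 * c / l ^ 2 < 2 * c / l := by
    gcongr
    exact lt_self_pow₀ hl one_lt_two
  filter_upwards [hlim.eventually_const_lt hlt, eventually_gt_atTop 1] with k hk hk1
  have hlogk : 0 < Real.log k := Real.log_pos (by exact_mod_cast hk1)
  exact ((lt_div_iff₀ (by positivity)).1 hk).le

theorem eventually_exp_le_rpow (hc : 0 < c) (hl : 1 < l) (hl2 : l < 2) :
    ∀ᶠ k : ℕ in atTop, Real.exp (-(blockCount l k * (k ^ 2 : ℕ) *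
      (l⁻¹ * (2 * geomThreshold c l k - 3 / 2 ^ k)))) ≤ (k : ℝ) ^ (-(2 * c / l ^ 4)) := by
  filter_upwards [eventually_pow_le_mul_blockCount_mul hl, eventually_mul_log_div_pow_le hc hl hl2,
    eventually_gt_atTop 0] with k hblock hthreshold hk
  have : 0 ≤ Real.log k := Real.log_natCast_nonneg k
  rw [Real.rpow_def_of_pos (by positivity), Real.exp_le_exp, mul_neg, neg_le_neg_iff,
    Nat.cast_pow]
  calc Real.log k * (2 * c / l ^ 4)
      = l ^ k / l * (l⁻¹ * (2 * c / l ^ 2 * (Real.log k / l ^ k))) := by field_simp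
    _ ≤ blockCount l k * (k : ℝ) ^ 2 * (l⁻¹ * (2 * geomThreshold c l k - 3 / 2 ^ k)) := by
        gcongr
        exact (div_le_iff₀' (by positivity)).2 hblock

theorem summable_measureReal_noReturnSet (hl : 1 < l) (hl2 : l < 2) (hlc : l ^ 4 < 2 * c) :
    Summable fun k : ℕ =>
      lebUnit.real (noReturnSet doublingMap ⌈l ^ k⌉₊ (geomThreshold c l k)) := by
  have hl0 : 0 < l := one_pos.trans hl
  have hc : 0 < c := by linarith [pow_pos hl0 4]
  have hlinv : 0 < 1 - l⁻¹ := sub_pos.2 (inv_lt_one_of_one_lt₀ hl)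
  have hsum_rpow : Summable fun k : ℕ => (k : ℝ) ^ (-(2 * c / l ^ 4)) := by
    rw [Real.summable_nat_rpow, neg_lt_neg_iff]
    exact (one_lt_div (by positivity)).2 hlc
  have hsum_geom : Summable fun k : ℕ =>
      (1 + 4 * (k ^ 2 : ℕ) / (1 - l⁻¹)) * (2 * (c * Real.log l / l * (k * l⁻¹ ^ k))) := by
    have hnorm : ‖l⁻¹‖ < 1 := by
      rw [Real.norm_of_nonneg (by positivity)]
      exact inv_lt_one_of_one_lt₀ hl
    refine (((summable_pow_mul_geometric_of_norm_lt_one 1 hnorm).add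
      ((summable_pow_mul_geometric_of_norm_lt_one 3 hnorm).mul_left (4 / (1 - l⁻¹)))).mul_left
      (2 * (c * Real.log l / l))).congr fun k => ?_
    push_cast
    ring
  refine (hsum_rpow.add hsum_geom).of_norm_bounded_eventually_nat ?_
  filter_upwards [eventually_add_blockCount_mul_le hl, eventually_exp_le_rpow hc hl hl2,
    eventually_geomThreshold_nonneg hc.le hl, eventually_gt_atTop 0] with k hblocks hexp hnonneg hk
  rw [Real.norm_of_nonneg measureReal_nonneg]
  refine (measureReal_noReturnSet_le hk hblocks hlinv (sub_le_self _ (by positivity))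
    hnonneg).trans ?_
  rw [sub_sub_cancel]
  gcongr
  exact geomThreshold_le hc.le hl k

end GeometricTimes

/-! ### The almost sure upper bound -/

theorem ae_eventually_minReturn_lt {c : ℝ} (hc : 1 / 2 < c) :
    ∀ᵐ x ∂lebUnit, ∀ᶠ n : ℕ in atTop,
      minReturn doublingMap n x < c * Real.log (Real.log n) / n := by
  have hc0 : 0 < c := by linarith
  obtain ⟨l, ⟨hl2, hlc⟩, hl⟩ : ∃ l : ℝ, (l < 2 ∧ l ^ 4 < 2 * c) ∧ 1 < l := by
    have hlim : Tendsto (fun l : ℝ => l ^ 4) (𝓝[>] 1) (𝓝 1) := by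
      simpa using (tendsto_nhdsWithin_of_tendsto_nhds ((continuous_pow (M := ℝ) 4).tendsto 1))
    exact ((((tendsto_id.mono_left nhdsWithin_le_nhds).eventually_lt_const one_lt_two).and
      (hlim.eventually_lt_const (by linarith))).and self_mem_nhdsWithin).exists
  have hne := (summable_measureReal_noReturnSet hl hl2 hlc).tsum_ofReal_ne_top
  simp only [ofReal_measureReal (measure_ne_top _ _)] at hne
  filter_upwards [ae_eventually_notMem hne] with x hx
  obtain ⟨K, hK⟩ := eventually_atTop.1
    (hx.and ((eventually_geomThreshold_nonneg hc0.le hl).and (eventually_gt_atTop 0)))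
  filter_upwards [tendsto_natCast_atTop_atTop.eventually_ge_atTop (l ^ K),
    eventually_ge_atTop 1] with n hKn hn
  obtain ⟨k, hkn, hnk⟩ := exists_nat_pow_near (x := (n : ℝ)) (by exact_mod_cast hn) hl
  have hKk : K ≤ k := Nat.lt_succ_iff.1 ((pow_lt_pow_iff_right₀ hl).1 (hKn.trans_lt hnk))
  obtain ⟨hxk, hnonneg, hk⟩ := hK k hKk
  exact minReturn_lt_of_notMem_noReturnSet hxk (Nat.ceil_le.2 hkn)
    (geomThreshold_le_div hc0 hl hk hnonneg hkn hnk)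

theorem isUpperBoundSequence_loglog {c : ℝ} (hc : 1 / 2 < c) :
    IsUpperBoundSequence (Set.Ico 0 1) (fun _ => 1)
      (fun n : ℕ => c * Real.log (Real.log n) / n) := by
  obtain ⟨c', hc', hc'c⟩ := exists_between hc
  refine ⟨fun _ _ => one_pos, 1, c', ⟨⟨0, by simp, rfl⟩, ?_⟩, by linarith, ?_⟩
  · rintro _ ⟨_, _, rfl⟩
    exact le_rfl
  · have hlim := Real.tendsto_log_atTop.comp
      (Real.tendsto_log_atTop.comp (tendsto_natCast_atTop_atTop (R := ℝ)))
    filter_upwards [hlim.eventually_gt_atTop 0, eventually_gt_atTop 0] with n hloglog hn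
    have : 0 < Real.log (Real.log n) := hloglog
    gcongr

theorem mainTheorem6 (c : ℝ) (hc : 1 / 2 < c) :
    IsHyperbolicRecurrent (Set.Ico 0 1) doublingMap lebUnit (fun _ => 1) ∧
    IsUpperBoundSequence (Set.Ico 0 1) (fun _ => 1)
      (fun n : ℕ => c * Real.log (Real.log n) / n) ∧
    ∀ᵐ x ∂lebUnit, ∀ᶠ n : ℕ in atTop,
      minReturn doublingMap n x < c * Real.log (Real.log n) / n :=
  ⟨isHyperbolicRecurrent_doublingMap, isUpperBoundSequence_loglog hc,
    ae_eventually_minReturn_lt hc⟩
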